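/- **Setting.** Let $\Theta \subset \mathbb{R}^d$ be a measurable set contained in a ball of radius $R$. An oblivious adversary draws, before the interaction begins, a (possibly random) sequence of loss functions $\ell_1, \ell_2, \dots : \Theta \to [0,1]$ and, for every round $t$, a feedback system, i.e. a measurable partition $A^{(t)}_1, \dots, A^{(t)}_M$ of $\Theta$ into $M$ sets; $A^{(t)}(\rho)$ denotes the set of this partition that contains $\rho$. Each $\ell_t$ is piecewise $L$-Lipschitz: $\Theta$ can be partitioned into finitely many regions on each of which $\ell_t$ is $L$-Lipschitz. The learner plays $\rho_t \in \Theta$ in round $t$ and then observes $A^{(t)}(\rho_t)$ and the values of $\ell_t$ on this set (semi-bandit feedback). *Dispersion.* The sequence is $\beta$-dispersed for the constant $L$ if there are constants $D, q$ such that for all $T \ge 1$ and all $\varepsilon \ge T^{-\beta}$, $$\mathbb{E}\Bigl[\max_{\rho \in \Theta,\; B(\rho,\varepsilon) \subset \Theta} \bigl|\{1 \le t \le T : \ell_t \text{ is not } L\text{-Lipschitz in } B(\rho,\varepsilon)\}\bigr|\Bigr] \le D\,(1+\log T)^q\,\varepsilon T .$$ *Interior minimizer.* The sequence has an $r_0$-interior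 minimizer, $r_0 > 0$, if with probability one, for every $T$ there is $\rho^* \in \operatorname{argmin}_{\rho\in\Theta} \sum_{t=1}^T \ell_t(\rho)$ with $B(\rho^*, r_0) \subset \Theta$. *Continuous Exp3-SET with step size $\lambda \in [0,1]$.* Put $w_1 = 1$ on $\Theta$. In round $t$, let $p_t(\rho) = w_t(\rho)/\int_\Theta w_t$, draw $\rho_t$ from the density $p_t$ on $\Theta$, and set $$\hat\ell_t(\rho) = \frac{\mathbf{1}\{\rho \in A^{(t)}(\rho_t)\}}{\int_{A^{(t)}(\rho_t)} p_t}\, \ell_t(\rho), \qquad w_{t+1}(\rho) = w_t(\rho)\, e^{-\lambda \hat\ell_t(\rho)} .$$ **Theorem.** Given $M, L, R, \beta$ there is a choice of step sizes $\lambda = \lambda(d,T) \in [0,1]$ such that for all $r_0 > 0$, $D$, $q$ there are constants $C, k$, depending only on $M, L, R, \beta, r_0, D, q$ (in particular not on $d$ or $T$), with the following property. For every $d$, every $\Theta \subset \mathbb{R}^d$ contained in a ball of radius $R$, and every adversary with piecewise $L$-Lipschitz losses and $M$ feedback sets per round as above whose losses are $\beta$-dispersed with constants $D, q$ and have an $r_0$-interior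 minimizer, and for every $T \ge 1$, running continuous Exp3-SET with $\lambda = \lambda(d,T)$ for $T$ rounds gives $$\mathbb{E}\Bigl[\sum_{t=1}^T \ell_t(\rho_t) - \ell_t(\rho^*)\Bigr] \le C\,(1+\log T)^k \bigl(\sqrt{dT} + T^{1-\beta}\bigr),$$ where $\rho^* \in \operatorname{argmin}_{\rho\in\Theta}\sum_{t=1}^T \ell_t(\rho)$ and the expectation is over the draw of the losses and feedback systems and the plays of the algorithm. That is, the expected regret is $\tilde O(\sqrt{dT} + T^{1-\beta})$. -/

import Mathlib

open MeasureTheory Set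
open scoped NNReal ENNReal

/-! Rounds are numbered `0, 1, 2, …`, so that the first `T` rounds are the `t < T`. Loss functions are
functions on all of `ℝ^d`, of which only the values on the parameter space `Θ` matter. -/

namespace Exp3Set

/-- `f` is piecewise `L`-Lipschitz on `Θ`: there is a partition of `Θ` into finitely many regions such
that `f` is `L`-Lipschitz on each of them. -/
def PiecewiseLipschitzOn {d : ℕ} (L : ℝ≥0) (f : EuclideanSpace ℝ (Fin d) → ℝ)
    (Θ : Set (EuclideanSpace ℝ (Fin d))) : Prop :=
  ∃ (N : ℕ) (P : Fin N → Set (EuclideanSpace ℝ (Fin d))),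
    Pairwise (Function.onFun Disjoint P) ∧ (⋃ i, P i) = Θ ∧ ∀ i, LipschitzOnWith L f (P i)

/-- A feedback system with `M` feedback sets: a measurable partition of `Θ`. -/
def IsFeedbackSystem {d M : ℕ} (Θ : Set (EuclideanSpace ℝ (Fin d)))
    (A : Fin M → Set (EuclideanSpace ℝ (Fin d))) : Prop :=
  (∀ i, MeasurableSet (A i)) ∧ Pairwise (Function.onFun Disjoint A) ∧ (⋃ i, A i) = Θ

open Classical in
/-- The number of functions among the first `T` that are not `L`-Lipschitz in the ball `B(ρ, ε)`. -/
noncomputable def nonLipschitzCount {d : ℕ} (L : ℝ≥0) (l : ℕ → EuclideanSpace ℝ (Fin d) → ℝ)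
    (T : ℕ) (ρ : EuclideanSpace ℝ (Fin d)) (ε : ℝ) : ℕ :=
  ((Finset.range T).filter fun t => ¬ LipschitzOnWith L (l t) (Metric.ball ρ ε)).card

/-- The random sequence of losses `l 0 ω, l 1 ω, …` is `β`-dispersed on `Θ` for the Lipschitz constant
`L`: for all `T ≥ 1` and `ε ≥ T^(-β)`, the expected value of the maximum over all `ε`-balls contained in
`Θ` of the number of functions among the first `T` that are not `L`-Lipschitz in that ball is
`Õ(ε T)`, that is, at most `D (1 + log T)^q ε T`. -/
def IsBetaDispersed {d : ℕ} {Ω : Type*} [MeasurableSpace Ω] (μ : Measure Ω)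
    (Θ : Set (EuclideanSpace ℝ (Fin d))) (L : ℝ≥0)
    (l : ℕ → Ω → EuclideanSpace ℝ (Fin d) → ℝ) (β D : ℝ) (q : ℕ) : Prop :=
  ∀ T : ℕ, 1 ≤ T → ∀ ε : ℝ, (T : ℝ) ^ (-β) ≤ ε →
    ∫⁻ ω, (⨆ ρ ∈ {ρ | ρ ∈ Θ ∧ Metric.ball ρ ε ⊆ Θ},
        (nonLipschitzCount L (fun t => l t ω) T ρ ε : ℝ≥0∞)) ∂μ
      ≤ ENNReal.ofReal (D * (1 + Real.log T) ^ q * (ε * T))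

/-- `ρ` is a best parameter in hindsight: it minimizes `∑_{t < T} l t` over `Θ`. -/
def IsBestInHindsight {d : ℕ} (Θ : Set (EuclideanSpace ℝ (Fin d)))
    (l : ℕ → EuclideanSpace ℝ (Fin d) → ℝ) (T : ℕ) (ρ : EuclideanSpace ℝ (Fin d)) : Prop :=
  ρ ∈ Θ ∧ IsMinOn (fun x => ∑ t ∈ Finset.range T, l t x) Θ ρ

/-- With probability one, for all `T` there is a best parameter in hindsight `ρ` with
`B(ρ, r₀) ⊆ Θ`. -/
def HasInteriorMinimizer {d : ℕ} {Ω : Type*} [MeasurableSpace Ω] (μ : Measure Ω)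
    (Θ : Set (EuclideanSpace ℝ (Fin d))) (l : ℕ → Ω → EuclideanSpace ℝ (Fin d) → ℝ) (r₀ : ℝ) :
    Prop :=
  ∀ᵐ ω ∂μ, ∀ T : ℕ, ∃ ρ, IsBestInHindsight Θ (fun t => l t ω) T ρ ∧ Metric.ball ρ r₀ ⊆ Θ

/-! The algorithm, run against a fixed sequence of losses `l` and feedback systems `A`. -/

/-- The feedback set `A(ρ)` that contains `ρ`. -/
def feedbackSet {d M : ℕ} (A : Fin M → Set (EuclideanSpace ℝ (Fin d)))
    (ρ : EuclideanSpace ℝ (Fin d)) : Set (EuclideanSpace ℝ (Fin d)) :=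
  {x | ∃ i, ρ ∈ A i ∧ x ∈ A i}

/-- `p(S) = ∫_S p(x) dx` for the density `p = w / ∫_Θ w` and a set `S ⊆ Θ`. -/
noncomputable def prob {d : ℕ} (Θ : Set (EuclideanSpace ℝ (Fin d)))
    (w : EuclideanSpace ℝ (Fin d) → ℝ) (S : Set (EuclideanSpace ℝ (Fin d))) : ℝ :=
  ∫ x in S, w x / ∫ y in Θ, w y

/-- The importance-weighted estimate `x ↦ 1{x ∈ A(ρ)} / p(A(ρ)) * f x` of the loss `f`, computed from
the current weights `w`, the play `ρ` and the feedback on `A(ρ)`. -/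
noncomputable def lossEstimate {d M : ℕ} (Θ : Set (EuclideanSpace ℝ (Fin d)))
    (w : EuclideanSpace ℝ (Fin d) → ℝ) (A : Fin M → Set (EuclideanSpace ℝ (Fin d)))
    (f : EuclideanSpace ℝ (Fin d) → ℝ) (ρ : EuclideanSpace ℝ (Fin d)) :
    EuclideanSpace ℝ (Fin d) → ℝ :=
  (feedbackSet A ρ).indicator fun x => f x / prob Θ w (feedbackSet A ρ)

/-- The weight function of continuous Exp3-SET with step size `lam` in force in round `t`, as a function
of the plays `h` of the rounds before `t`. -/
noncomputable def weight {d M : ℕ} (Θ : Set (EuclideanSpace ℝ (Fin d))) (lam : ℝ)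
    (l : ℕ → EuclideanSpace ℝ (Fin d) → ℝ) (A : ℕ → Fin M → Set (EuclideanSpace ℝ (Fin d))) :
    (t : ℕ) → (Fin t → EuclideanSpace ℝ (Fin d)) → EuclideanSpace ℝ (Fin d) → ℝ
  | 0, _ => fun _ => 1
  | t + 1, h => fun x =>
      weight Θ lam l A t (Fin.init h) x *
        Real.exp (-lam *
          lossEstimate Θ (weight Θ lam l A t (Fin.init h)) (A t) (l t) (h (Fin.last t)) x)

/-- The distribution on `Θ` with density `w / ∫_Θ w`. -/
noncomputable def playDist {d : ℕ} (Θ : Set (EuclideanSpace ℝ (Fin d)))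
    (w : EuclideanSpace ℝ (Fin d) → ℝ) : Measure (EuclideanSpace ℝ (Fin d)) :=
  (volume.restrict Θ).withDensity fun x => ENNReal.ofReal (w x / ∫ y in Θ, w y)

/-- The joint law of the plays of the first `T` rounds: given the plays `h` of the rounds before `t`, the
play of round `t` is drawn from the density proportional to the current weights. -/
noncomputable def playLaw {d M : ℕ} (Θ : Set (EuclideanSpace ℝ (Fin d))) (lam : ℝ)
    (l : ℕ → EuclideanSpace ℝ (Fin d) → ℝ) (A : ℕ → Fin M → Set (EuclideanSpace ℝ (Fin d))) :
    (T : ℕ) → Measure (Fin T → EuclideanSpace ℝ (Fin d))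
  | 0 => Measure.dirac Fin.elim0
  | t + 1 => (playLaw Θ lam l A t).bind fun h =>
      (playDist Θ (weight Θ lam l A t h)).map fun x =>
        (Fin.snoc h x : Fin (t + 1) → EuclideanSpace ℝ (Fin d))

/-- The expectation, over the learner's randomness only, of `∑_{t < T} (l t (ρ_t) - l t ρstar)`. -/
noncomputable def condRegret {d M : ℕ} (Θ : Set (EuclideanSpace ℝ (Fin d))) (lam : ℝ)
    (l : ℕ → EuclideanSpace ℝ (Fin d) → ℝ) (A : ℕ → Fin M → Set (EuclideanSpace ℝ (Fin d)))
    (T : ℕ) (ρstar : EuclideanSpace ℝ (Fin d)) : ℝ :=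
  ∫ h, ∑ t : Fin T, (l t (h t) - l t ρstar) ∂(playLaw Θ lam l A T)

/-- The expected regret over the first `T` rounds against an oblivious adversary that draws the losses
and feedback systems `ω ∼ μ` before the interaction. The plays lie in `Θ`, so for a best parameter in
hindsight `ρstar ω` the inner expectation is nonnegative and `ENNReal.ofReal` does not change it. -/
noncomputable def expectedRegret {d M : ℕ} {Ω : Type*} [MeasurableSpace Ω] (μ : Measure Ω)
    (Θ : Set (EuclideanSpace ℝ (Fin d))) (lam : ℝ)
    (l : ℕ → Ω → EuclideanSpace ℝ (Fin d) → ℝ)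
    (A : ℕ → Ω → Fin M → Set (EuclideanSpace ℝ (Fin d)))
    (T : ℕ) (ρstar : Ω → EuclideanSpace ℝ (Fin d)) : ℝ≥0∞ :=
  ∫⁻ ω, ENNReal.ofReal (condRegret Θ lam (fun t => l t ω) (fun t => A t ω) T (ρstar ω)) ∂μ

end Exp3Set

/-! Fix the adversary's draw and a probability measure `ν` on `Θ` to compete with, and follow the
potential `log ∫ w - ∫ log w ∂ν`. Averaged over the play, the estimated loss has the true loss as
its mean under the play distribution and at most the true loss as its mean under `ν`. Its second
moment is at most one per feedback set, because the factor `1 / p(A)` left after integrating the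
square occurs only with probability `p(A)`. So one round lowers the expected potential by at least
`lam` times (learner's loss minus loss of `ν`), up to an error `lam ^ 2 * M / 2`
(`integral_potential_updateWeight_le`). The potential starts at `log vol Θ`. If `ν` is uniform on `B
⊆ Θ`, Jensen keeps it above `log vol B` on every history (`log_volume_le_potential`). Hence the
regret against `ν` is at most `log (vol Θ / vol B) / lam + lam * M * T / 2`
(`condRegret_le_of_subset`).

Take for `B` the ball of radius `ε = T ^ (-β)` about an interior minimizer. The logarithm is at most
`d * log (R / ε)`. A round whose loss is Lipschitz on `B` costs at most `L * ε` more than at the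
center, any other round at most `1`, and dispersion bounds the expected number of the latter by a
multiple of `ε * T`, up to logarithms. The step size `√(d / T)` balances the first two terms. If `T
≤ d`, or if `B` might not fit into `Θ` because `r₀ < ε`, the trivial regret bound `T` is already
good enough. -/

namespace Exp3Set

/-! ### One round of the algorithm: the expected change of the potential -/

section OneStep

variable {d M : ℕ} {Θ : Set (EuclideanSpace ℝ (Fin d))}
  {A : Fin M → Set (EuclideanSpace ℝ (Fin d))}

theorem feedbackSet_of_mem (hA : IsFeedbackSystem Θ A) {i : Fin M}
    {ρ : EuclideanSpace ℝ (Fin d)} (hρ : ρ ∈ A i) : feedbackSet A ρ = A i := by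
  ext x
  constructor
  · rintro ⟨j, hj, hx⟩
    obtain rfl : i = j := by
      by_contra hij
      exact Set.disjoint_left.1 (hA.2.1 hij) hρ hj
    exact hx
  · exact fun hx => ⟨i, hρ, hx⟩

theorem IsFeedbackSystem.subset (hA : IsFeedbackSystem Θ A) (i : Fin M) : A i ⊆ Θ :=
  hA.2.2 ▸ Set.subset_iUnion A i

theorem IsFeedbackSystem.exists_mem (hA : IsFeedbackSystem Θ A)
    {ρ : EuclideanSpace ℝ (Fin d)} (hρ : ρ ∈ Θ) : ∃ i, ρ ∈ A i := by
  rw [← hA.2.2] at hρ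
  exact Set.mem_iUnion.1 hρ

theorem feedbackSet_of_notMem (hA : IsFeedbackSystem Θ A)
    {ρ : EuclideanSpace ℝ (Fin d)} (hρ : ρ ∉ Θ) : feedbackSet A ρ = ∅ := by
  ext x
  simp only [feedbackSet, Set.mem_ofPred_eq, Set.mem_empty_iff_false, iff_false]
  rintro ⟨j, hj, -⟩
  exact hρ (hA.subset j hj)

/-- Since `(1 - z + z²/2) (1 + z + z²/2) = 1 + z⁴/4 ≥ 1`, this follows from the quadratic lower
bound for `exp z`. -/
theorem exp_neg_le_quadratic {z : ℝ} (hz : 0 ≤ z) : Real.exp (-z) ≤ 1 - z + z ^ 2 / 2 := by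
  have h1 := Real.quadratic_le_exp_of_nonneg hz
  have h2 : 0 < Real.exp (-z) := Real.exp_pos _
  have h3 : Real.exp (-z) * Real.exp z = 1 := by rw [← Real.exp_add]; simp
  have h4 : 0 ≤ 1 - z + z ^ 2 / 2 := by nlinarith [sq_nonneg (z - 1)]
  have h5 : 1 ≤ (1 - z + z ^ 2 / 2) * Real.exp z := by
    calc (1 : ℝ) ≤ (1 - z + z ^ 2 / 2) * (1 + z + z ^ 2 / 2) := by nlinarith [sq_nonneg (z ^ 2)]
      _ ≤ _ := mul_le_mul_of_nonneg_left h1 h4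
  have h6 := mul_le_mul_of_nonneg_left h5 h2.le
  nlinarith

variable {w : EuclideanSpace ℝ (Fin d) → ℝ} {c : ℝ}

theorem integrable_of_bounds {X : Type*} [MeasurableSpace X] {ν : Measure X} [IsFiniteMeasure ν]
    {f : X → ℝ} (hf : Measurable f) {a b : ℝ} (h : ∀ᵐ x ∂ν, f x ∈ Set.Icc a b) :
    Integrable f ν :=
  Integrable.of_mem_Icc a b hf.aemeasurable h

theorem setIntegral_weight_pos (h0 : volume Θ ≠ 0) (hfin : volume Θ ≠ ⊤)
    (hw : Measurable w) (hc : 0 < c) (hcw : ∀ x, w x ∈ Set.Icc c 1) :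
    c * volume.real Θ ≤ ∫ y in Θ, w y ∧ 0 < ∫ y in Θ, w y := by
  have : Fact (volume Θ < ⊤) := ⟨hfin.lt_top⟩
  have h1 : c * volume.real Θ ≤ ∫ y in Θ, w y := by
    calc c * volume.real Θ = ∫ _ in Θ, c := by simp [mul_comm]
      _ ≤ _ := integral_mono (integrable_const _)
        (integrable_of_bounds hw (Filter.Eventually.of_forall hcw)) fun x => (hcw x).1
  exact ⟨h1, lt_of_lt_of_le (mul_pos hc (ENNReal.toReal_pos h0 hfin)) h1⟩

theorem integral_playDist (hw : Measurable w) (hw0 : ∀ x, 0 ≤ w x)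
    (f : EuclideanSpace ℝ (Fin d) → ℝ) :
    ∫ x, f x ∂(playDist Θ w) = (∫ x in Θ, w x * f x) / ∫ y in Θ, w y := by
  rw [playDist, integral_withDensity_eq_integral_toReal_smul (by fun_prop) (by simp),
    ← integral_div]
  congr 1 with x
  rw [ENNReal.toReal_ofReal (div_nonneg (hw0 x) (integral_nonneg hw0))]
  simp only [smul_eq_mul]
  ring

theorem isProbabilityMeasure_playDist (h0 : volume Θ ≠ 0) (hfin : volume Θ ≠ ⊤)
    (hw : Measurable w) (hc : 0 < c) (hcw : ∀ x, w x ∈ Set.Icc c 1) :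
    IsProbabilityMeasure (playDist Θ w) := by
  have : Fact (volume Θ < ⊤) := ⟨hfin.lt_top⟩
  have hW := (setIntegral_weight_pos h0 hfin hw hc hcw).2
  have hw0 : ∀ x, 0 ≤ w x := fun x => hc.le.trans (hcw x).1
  have hint : Integrable w (volume.restrict Θ) :=
    integrable_of_bounds hw (Filter.Eventually.of_forall hcw)
  constructor
  rw [playDist, withDensity_apply _ MeasurableSet.univ, Measure.restrict_univ,
    ← ofReal_integral_eq_lintegral_ofReal (hint.div_const _)
      (Filter.Eventually.of_forall fun x => div_nonneg (hw0 x) hW.le),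
    integral_div, div_self hW.ne', ENNReal.ofReal_one]

theorem playDist_ae_mem (hΘ : MeasurableSet Θ) : ∀ᵐ x ∂(playDist Θ w), x ∈ Θ :=
  (withDensity_absolutelyContinuous _ _).ae_le (ae_restrict_mem hΘ)

theorem prob_eq_playDist_real (hw : Measurable w) (hw0 : ∀ x, 0 ≤ w x)
    {S : Set (EuclideanSpace ℝ (Fin d))} (hS : MeasurableSet S) (hSΘ : S ⊆ Θ) :
    prob Θ w S = (playDist Θ w).real S := by
  have h1 : (playDist Θ w).real S = ∫ x, S.indicator (fun _ => (1 : ℝ)) x ∂(playDist Θ w) := by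
    rw [integral_indicator hS]; simp
  rw [h1, integral_playDist hw hw0, prob, integral_div]
  congr 1
  have h2 : (fun x => w x * S.indicator (fun _ => (1 : ℝ)) x) = S.indicator w := by
    ext x
    by_cases hx : x ∈ S <;> simp [hx]
  rw [h2, integral_indicator hS, Measure.restrict_restrict hS, Set.inter_eq_left.2 hSΘ]

/-- An integral over a measure carried by `Θ` splits along a feedback system. -/
theorem IsFeedbackSystem.integral_eq_sum (hA : IsFeedbackSystem Θ A)
    {ν : Measure (EuclideanSpace ℝ (Fin d))} (hν : ∀ᵐ x ∂ν, x ∈ Θ)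
    {f : EuclideanSpace ℝ (Fin d) → ℝ} (hf : ∀ i, IntegrableOn f (A i) ν) :
    ∫ x, f x ∂ν = ∑ i, ∫ x in A i, f x ∂ν := by
  rw [← integral_iUnion_fintype hA.1 hA.2.1 hf, hA.2.2, Measure.restrict_eq_self_of_ae_mem hν]

/-- The bound on the change of the potential for one feedback set of probability `a > 0`. -/
theorem potential_le_of_prob_pos {X : Type*} [MeasurableSpace X] {P ν : Measure X}
    [IsProbabilityMeasure P] [IsProbabilityMeasure ν] {S : Set X} (hS : MeasurableSet S)
    {f : X → ℝ} (hf : Measurable f) (hf01 : ∀ x ∈ S, f x ∈ Set.Icc (0 : ℝ) 1) {lam : ℝ}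
    (hlam : 0 ≤ lam) (ha : 0 < P.real S) :
    Real.log (∫ x, Real.exp (-lam * S.indicator (fun x => f x / P.real S) x) ∂P)
        + ∫ x, lam * S.indicator (fun x => f x / P.real S) x ∂ν
      ≤ (-lam * ∫ x in S, f x ∂P) / P.real S + lam ^ 2 / 2 / P.real S
        + lam * (∫ x in S, f x ∂ν) / P.real S := by
  set a := P.real S with ha_def
  set g := S.indicator (fun x => f x / a) with hg
  have hgm : Measurable g := (hf.div_const a).indicator hS
  have hg0 : ∀ x, g x ∈ Set.Icc (0 : ℝ) (1 / a) := by
    intro x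
    by_cases hx : x ∈ S
    · simp only [hg, Set.indicator_of_mem hx]
      exact ⟨div_nonneg (hf01 x hx).1 ha.le, by gcongr; exact (hf01 x hx).2⟩
    · simp only [hg, Set.indicator_of_notMem hx]
      exact ⟨le_rfl, by positivity⟩
  have hgi : ∀ (m : Measure X) [IsProbabilityMeasure m], Integrable g m := fun m _ =>
    integrable_of_bounds hgm (Filter.Eventually.of_forall hg0)
  have hgint : ∀ (m : Measure X) [IsProbabilityMeasure m], ∫ x, g x ∂m = (∫ x in S, f x ∂m) / a := by
    intro m _
    rw [hg, integral_indicator hS, integral_div]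
  -- Integrated over `P` this is `1 / a`: one factor `1 / a` cancels against the mass of `S`, the
  -- other against the probability `a` of playing in `S`.
  have hsq : ∀ x, g x ^ 2 ≤ S.indicator (fun _ => 1 / a ^ 2) x := by
    intro x
    by_cases hx : x ∈ S
    · rw [Set.indicator_of_mem hx, ← one_div_pow]
      exact pow_le_pow_left₀ (hg0 x).1 (hg0 x).2 2
    · simp [hg, hx]
  have hexp : ∀ x, Real.exp (-lam * g x) ∈ Set.Icc (0 : ℝ) 1 := fun x =>
    ⟨(Real.exp_pos _).le, Real.exp_le_one_iff.2 (by nlinarith [(hg0 x).1])⟩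
  have hexpi : Integrable (fun x => Real.exp (-lam * g x)) P :=
    integrable_of_bounds (by fun_prop) (Filter.Eventually.of_forall hexp)
  have hSi : Integrable (S.indicator (fun _ => 1 / a ^ 2)) P :=
    (integrable_const _).indicator hS
  have h1 : ∫ x, Real.exp (-lam * g x) ∂P
      ≤ ∫ x, (1 - lam * g x + lam ^ 2 / 2 * S.indicator (fun _ => 1 / a ^ 2) x) ∂P := by
    refine integral_mono hexpi
      (((integrable_const _).sub ((hgi P).const_mul _)).add (hSi.const_mul _)) fun x => ?_
    have h2 := exp_neg_le_quadratic (mul_nonneg hlam (hg0 x).1)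
    rw [← neg_mul] at h2
    have h3 := mul_le_mul_of_nonneg_left (hsq x) (by positivity : 0 ≤ lam ^ 2 / 2)
    simp only
    linarith [mul_pow lam (g x) 2]
  rw [integral_add (f := fun x => 1 - lam * g x)
      ((integrable_const _).sub ((hgi P).const_mul _)) (hSi.const_mul _),
    integral_sub (integrable_const _) ((hgi P).const_mul _), integral_const_mul,
    integral_const_mul, hgint P, integral_indicator hS] at h1
  simp only [integral_const, measureReal_restrict_apply_univ, probReal_univ, smul_eq_mul,
    mul_one, ← ha_def] at h1
  have h4 := Real.log_le_sub_one_of_pos (integral_exp_pos hexpi)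
  rw [integral_const_mul, hgint ν]
  have h5 : lam ^ 2 / 2 * (a * (1 / a ^ 2)) = lam ^ 2 / 2 / a := by field_simp
  rw [h5] at h1
  have h6 : lam * ((∫ x in S, f x ∂ν) / a) = lam * (∫ x in S, f x ∂ν) / a := by ring
  have h7 : lam * ((∫ x in S, f x ∂P) / a) = - ((-lam * ∫ x in S, f x ∂P) / a) := by ring
  rw [h6]
  rw [h7] at h1
  linarith

/-- The weights after one round of continuous Exp3-SET with play `ρ`. -/
noncomputable def updateWeight (Θ : Set (EuclideanSpace ℝ (Fin d))) (lam : ℝ)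
    (w : EuclideanSpace ℝ (Fin d) → ℝ) (A : Fin M → Set (EuclideanSpace ℝ (Fin d)))
    (f : EuclideanSpace ℝ (Fin d) → ℝ) (ρ x : EuclideanSpace ℝ (Fin d)) : ℝ :=
  w x * Real.exp (-lam * lossEstimate Θ w A f ρ x)

/-- The logarithm of the total weight minus the `ν`-average of the logarithm of the weight. -/
noncomputable def potential (Θ : Set (EuclideanSpace ℝ (Fin d)))
    (ν : Measure (EuclideanSpace ℝ (Fin d))) (w : EuclideanSpace ℝ (Fin d) → ℝ) : ℝ :=
  Real.log (∫ x in Θ, w x) - ∫ x, Real.log (w x) ∂ν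

/-- Importance weighting makes the first-order terms telescope to the true losses, and each of the
`M` feedback sets adds a second-order term of at most `lam ^ 2 / 2`, whatever its probability. -/
theorem integral_potential_updateWeight_le (hΘ : MeasurableSet Θ) (h0 : volume Θ ≠ 0)
    (hfin : volume Θ ≠ ⊤) (hw : Measurable w) (hc : 0 < c) (hcw : ∀ x, w x ∈ Set.Icc c 1)
    (hA : IsFeedbackSystem Θ A) {f : EuclideanSpace ℝ (Fin d) → ℝ} (hf : Measurable f)
    (hf01 : ∀ x ∈ Θ, f x ∈ Set.Icc (0 : ℝ) 1) {lam : ℝ} (hlam : 0 ≤ lam)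
    {ν : Measure (EuclideanSpace ℝ (Fin d))} [IsProbabilityMeasure ν] (hν : ∀ᵐ x ∂ν, x ∈ Θ) :
    ∫ ρ, potential Θ ν (updateWeight Θ lam w A f ρ) ∂(playDist Θ w)
      ≤ potential Θ ν w - lam * ∫ x, f x ∂(playDist Θ w) + lam ^ 2 * M / 2
        + lam * ∫ x, f x ∂ν := by
  have hw0 : ∀ x, 0 < w x := fun x => hc.trans_le (hcw x).1
  have hW := (setIntegral_weight_pos h0 hfin hw hc hcw).2
  have hP := isProbabilityMeasure_playDist h0 hfin hw hc hcw
  have hPΘ := playDist_ae_mem (w := w) hΘ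
  set P := playDist Θ w with hPdef
  let g : Fin M → EuclideanSpace ℝ (Fin d) → ℝ := fun i =>
    (A i).indicator fun x => f x / P.real (A i)
  have hgm : ∀ i, Measurable (g i) := fun i => (hf.div_const _).indicator (hA.1 i)
  have hfi : ∀ (m : Measure (EuclideanSpace ℝ (Fin d))) [IsProbabilityMeasure m],
      (∀ᵐ x ∂m, x ∈ Θ) → Integrable f m := fun m _ hm =>
    integrable_of_bounds hf (hm.mono hf01)
  let Ψ : Fin M → ℝ := fun i => potential Θ ν fun x => w x * Real.exp (-lam * g i x)
  -- The new weights depend on the play only through its feedback set, so the average over plays is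
  -- a finite sum.
  have hΨ : ∀ i, ∀ ρ ∈ A i, potential Θ ν (updateWeight Θ lam w A f ρ) = Ψ i := by
    intro i ρ hρ
    have h1 : updateWeight Θ lam w A f ρ = fun x => w x * Real.exp (-lam * g i x) := by
      ext x
      simp only [updateWeight, lossEstimate, feedbackSet_of_mem hA hρ,
        prob_eq_playDist_real hw (fun x => (hw0 x).le) (hA.1 i) (hA.subset i), g, hPdef]
    rw [h1]
  have hsum : ∫ ρ, potential Θ ν (updateWeight Θ lam w A f ρ) ∂P = ∑ i, P.real (A i) * Ψ i := by
    rw [hA.integral_eq_sum hPΘ fun i =>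
      (integrableOn_congr_fun (hΨ i) (hA.1 i)).2 integrableOn_const]
    refine Finset.sum_congr rfl fun i _ => ?_
    rw [setIntegral_congr_fun (hA.1 i) (hΨ i)]
    simp
  have hone : ∑ i, P.real (A i) = 1 := by
    have := hA.integral_eq_sum hPΘ (f := fun _ => (1 : ℝ)) fun i => integrableOn_const
    simpa using this.symm
  have hlogw : Integrable (fun x => Real.log (w x)) ν :=
    integrable_of_bounds (Real.measurable_log.comp hw) (a := Real.log c) (b := 0)
      (Filter.Eventually.of_forall fun x =>
        ⟨Real.log_le_log hc (hcw x).1, Real.log_nonpos (hw0 x).le (hcw x).2⟩)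
  have hgi : ∀ i (m : Measure (EuclideanSpace ℝ (Fin d))) [IsProbabilityMeasure m],
      (∀ᵐ x ∂m, x ∈ Θ) → Integrable (g i) m := fun i m _ hm =>
    ((hfi m hm).div_const _).indicator (hA.1 i)
  have hstep : ∀ i, Ψ i = potential Θ ν w
      + (Real.log (∫ x, Real.exp (-lam * g i x) ∂P) + ∫ x, lam * g i x ∂ν) := by
    intro i
    have hpos : 0 < ∫ x, Real.exp (-lam * g i x) ∂P := by
      refine integral_exp_pos (integrable_of_bounds (a := 0) (b := 1)
        (Real.measurable_exp.comp ((hgm i).const_mul _))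
        (Filter.Eventually.of_forall fun x => ⟨(Real.exp_pos _).le, Real.exp_le_one_iff.2 ?_⟩))
      have : 0 ≤ g i x := Set.indicator_nonneg
        (fun x hx => div_nonneg (hf01 x (hA.subset i hx)).1 measureReal_nonneg) x
      nlinarith
    have h1 : ∫ x in Θ, w x * Real.exp (-lam * g i x)
        = (∫ x in Θ, w x) * ∫ x, Real.exp (-lam * g i x) ∂P := by
      rw [hPdef, integral_playDist hw fun x => (hw0 x).le, mul_div_cancel₀ _ hW.ne']
    have h2 : ∫ x, Real.log (w x * Real.exp (-lam * g i x)) ∂ν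
        = ∫ x, Real.log (w x) ∂ν - ∫ x, lam * g i x ∂ν := by
      rw [← integral_sub hlogw ((hgi i ν hν).const_mul _)]
      congr 1 with x
      rw [Real.log_mul (hw0 x).ne' (Real.exp_pos _).ne', Real.log_exp]
      ring
    simp only [Ψ, potential, h1, h2]
    rw [Real.log_mul hW.ne' hpos.ne']
    ring
  have hbound : ∀ i, P.real (A i) * Ψ i ≤ P.real (A i) * potential Θ ν w
      - lam * (∫ x in A i, f x ∂P) + lam ^ 2 / 2 + lam * ∫ x in A i, f x ∂ν := by
    intro i
    -- A set that is almost surely not played contributes nothing on the left, yet `ν` may charge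
    -- it. Its true loss is nonnegative, so the inequality survives.
    rcases (measureReal_nonneg (μ := P) (s := A i)).eq_or_lt with ha | ha
    · have h1 : ∫ x in A i, f x ∂P = 0 :=
        setIntegral_measure_zero f ((measureReal_eq_zero_iff).1 ha.symm)
      have h2 : 0 ≤ ∫ x in A i, f x ∂ν :=
        setIntegral_nonneg (hA.1 i) fun x hx => (hf01 x (hA.subset i hx)).1
      rw [← ha, h1]
      have := mul_nonneg hlam h2
      nlinarith [sq_nonneg lam]
    · have h1 := potential_le_of_prob_pos (P := P) (ν := ν) (hA.1 i) hf
        (fun x hx => hf01 x (hA.subset i hx)) hlam ha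
      rw [hstep i, mul_add]
      have h2 := mul_le_mul_of_nonneg_left h1 ha.le
      have h3 : P.real (A i) * ((-lam * ∫ x in A i, f x ∂P) / P.real (A i)
          + lam ^ 2 / 2 / P.real (A i) + lam * (∫ x in A i, f x ∂ν) / P.real (A i))
          = - lam * (∫ x in A i, f x ∂P) + lam ^ 2 / 2 + lam * ∫ x in A i, f x ∂ν := by
        field_simp
      rw [h3] at h2
      linarith
  rw [hsum]
  refine (Finset.sum_le_sum fun i _ => hbound i).trans_eq ?_
  simp only [Finset.sum_add_distrib, Finset.sum_sub_distrib, ← Finset.mul_sum, ← Finset.sum_mul,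
    hone, Finset.sum_const, Finset.card_univ, Fintype.card_fin, nsmul_eq_mul]
  rw [← hA.integral_eq_sum hPΘ fun i => (hfi P hPΘ).integrableOn,
    ← hA.integral_eq_sum hν fun i => (hfi ν hν).integrableOn]
  ring

end OneStep

/-! ### Joint measurability in the history and the point -/

section Measurability

variable {d M : ℕ} {Θ : Set (EuclideanSpace ℝ (Fin d))}
  {α : Type*} [MeasurableSpace α] {w : α → EuclideanSpace ℝ (Fin d) → ℝ}

theorem measurable_prob (hw : Measurable (Function.uncurry w))
    (S : Set (EuclideanSpace ℝ (Fin d))) : Measurable fun a => prob Θ (w a) S := by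
  have h : ∀ U : Set (EuclideanSpace ℝ (Fin d)), Measurable fun a => ∫ x in U, w a x := fun U =>
    (hw.stronglyMeasurable.integral_prod_right (ν := volume.restrict U)).measurable
  simp only [prob, integral_div]
  exact (h S).div (h Θ)

-- A finite sum over pairs of memberships, from which joint measurability and uniform bounds can be
-- read off term by term.
open Classical in
theorem lossEstimate_eq_sum {A : Fin M → Set (EuclideanSpace ℝ (Fin d))}
    (hA : IsFeedbackSystem Θ A) (v f : EuclideanSpace ℝ (Fin d) → ℝ)
    (ρ x : EuclideanSpace ℝ (Fin d)) :
    lossEstimate Θ v A f ρ x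
      = ∑ i, if ρ ∈ A i then (if x ∈ A i then f x / prob Θ v (A i) else 0) else 0 := by
  by_cases hρ : ρ ∈ Θ
  · obtain ⟨i, hi⟩ := hA.exists_mem hρ
    rw [Finset.sum_eq_single i]
    · rw [lossEstimate, feedbackSet_of_mem hA hi, if_pos hi, Set.indicator_apply]
    · intro j _ hj
      exact if_neg fun hj' => Set.disjoint_left.1 (hA.2.1 hj) hj' hi
    · simp
  · rw [lossEstimate, feedbackSet_of_notMem hA hρ, Set.indicator_empty]
    exact (Finset.sum_eq_zero fun i _ => if_neg fun hi => hρ (hA.subset i hi)).symm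

theorem measurable_lossEstimate {A : Fin M → Set (EuclideanSpace ℝ (Fin d))}
    (hA : IsFeedbackSystem Θ A) (hw : Measurable (Function.uncurry w))
    {f : EuclideanSpace ℝ (Fin d) → ℝ} (hf : Measurable f) :
    Measurable fun p : (α × EuclideanSpace ℝ (Fin d)) × EuclideanSpace ℝ (Fin d) =>
      lossEstimate Θ (w p.1.1) A f p.1.2 p.2 := by
  classical
  simp only [lossEstimate_eq_sum hA]
  refine Finset.measurable_sum _ fun i _ => ?_
  refine Measurable.ite ((measurable_snd.comp measurable_fst) (hA.1 i)) ?_ measurable_const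
  refine Measurable.ite (measurable_snd (hA.1 i)) ?_ measurable_const
  exact (hf.comp measurable_snd).div
    ((measurable_prob hw _).comp (measurable_fst.comp measurable_fst))

theorem measurable_playDist (hw : Measurable (Function.uncurry w)) :
    Measurable fun a => playDist Θ (w a) := by
  refine Measure.measurable_of_measurable_coe _ fun s hs => ?_
  simp only [playDist, withDensity_apply _ hs]
  refine Measurable.lintegral_prod_right' (ν := (volume.restrict Θ).restrict s)
    (f := fun p : α × EuclideanSpace ℝ (Fin d) =>
      ENNReal.ofReal (w p.1 p.2 / ∫ y in Θ, w p.1 y)) ?_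
  exact (hw.div ((hw.stronglyMeasurable.integral_prod_right
    (ν := volume.restrict Θ)).measurable.comp measurable_fst)).ennreal_ofReal

theorem measurable_potential {ν : Measure (EuclideanSpace ℝ (Fin d))} [SFinite ν]
    (hw : Measurable (Function.uncurry w)) : Measurable fun a => potential Θ ν (w a) := by
  refine Measurable.sub (Real.measurable_log.comp
    (hw.stronglyMeasurable.integral_prod_right (ν := volume.restrict Θ)).measurable) ?_
  exact (StronglyMeasurable.integral_prod_right (ν := ν) (f := fun a x => Real.log (w a x))
    (Real.measurable_log.comp hw).stronglyMeasurable).measurable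

end Measurability

/-! ### The law of the plays against a fixed sequence -/

section Instance

variable {d M : ℕ}

/-- A fixed sequence of losses and feedback systems on a parameter space of positive finite volume. -/
structure IsInstance (Θ : Set (EuclideanSpace ℝ (Fin d))) (l : ℕ → EuclideanSpace ℝ (Fin d) → ℝ)
    (A : ℕ → Fin M → Set (EuclideanSpace ℝ (Fin d))) : Prop where
  measurableSet : MeasurableSet Θ
  volume_ne_zero : volume Θ ≠ 0
  volume_ne_top : volume Θ ≠ ⊤
  measurable_loss : ∀ t, Measurable (l t)
  loss_mem : ∀ t, ∀ x ∈ Θ, l t x ∈ Set.Icc (0 : ℝ) 1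
  feedback : ∀ t, IsFeedbackSystem Θ (A t)

variable {Θ : Set (EuclideanSpace ℝ (Fin d))} {l : ℕ → EuclideanSpace ℝ (Fin d) → ℝ}
  {A : ℕ → Fin M → Set (EuclideanSpace ℝ (Fin d))} {lam : ℝ}

theorem measurable_snoc (t : ℕ) {X : Type*} [MeasurableSpace X] :
    Measurable fun p : (Fin t → X) × X => (Fin.snoc p.1 p.2 : Fin (t + 1) → X) := by
  refine measurable_pi_lambda _ fun i => ?_
  refine Fin.lastCases ?_ (fun j => ?_) i
  · simpa using measurable_snd
  · simp only [Fin.snoc_castSucc]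
    exact (measurable_pi_apply j).comp measurable_fst

theorem measurable_snoc_left {t : ℕ} {X : Type*} [MeasurableSpace X] (h : Fin t → X) :
    Measurable fun x : X => (Fin.snoc h x : Fin (t + 1) → X) :=
  (measurable_snoc t).comp measurable_prodMk_left

theorem measurable_init (t : ℕ) {X : Type*} [MeasurableSpace X] :
    Measurable fun h : Fin (t + 1) → X => (Fin.init h : Fin t → X) :=
  measurable_pi_lambda _ fun _ => measurable_pi_apply _

theorem IsInstance.measurable_weight (H : IsInstance Θ l A) (t : ℕ) :
    Measurable (Function.uncurry (weight Θ lam l A t)) := by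
  induction t with
  | zero => exact measurable_const
  | succ t ih =>
    have h1 : Measurable fun p : (Fin (t + 1) → EuclideanSpace ℝ (Fin d)) ×
        EuclideanSpace ℝ (Fin d) => (((Fin.init p.1 : Fin t → EuclideanSpace ℝ (Fin d)),
          p.1 (Fin.last t)), p.2) :=
      (((measurable_init t).comp measurable_fst).prodMk
        ((measurable_pi_apply _).comp measurable_fst)).prodMk measurable_snd
    have h2 := (measurable_lossEstimate (H.feedback t) ih (H.measurable_loss t)).comp h1
    have h3 := ih.comp (((measurable_init (X := EuclideanSpace ℝ (Fin d)) t).comp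
      measurable_fst).prodMk (measurable_snd (β := EuclideanSpace ℝ (Fin d))))
    exact h3.mul (Real.measurable_exp.comp (h2.const_mul (-lam)))

theorem weight_snoc (t : ℕ) (h : Fin t → EuclideanSpace ℝ (Fin d))
    (x : EuclideanSpace ℝ (Fin d)) :
    weight Θ lam l A (t + 1) (Fin.snoc h x)
      = updateWeight Θ lam (weight Θ lam l A t h) (A t) (l t) x := by
  ext y
  simp [weight, updateWeight]

/-- The constant is uniform over histories and points but deteriorates with `t`. It serves only to
make logarithms and integrals finite and never enters the regret bound. -/
theorem IsInstance.exists_weight_bound (H : IsInstance Θ l A) (hlam : 0 ≤ lam) (t : ℕ) :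
    ∃ c, 0 < c ∧ ∀ h x, weight Θ lam l A t h x ∈ Set.Icc c 1 := by
  induction t with
  | zero => exact ⟨1, one_pos, fun h x => by simp [weight]⟩
  | succ t ih =>
    obtain ⟨c, hc, hcw⟩ := ih
    have : Fact (volume Θ < ⊤) := ⟨H.volume_ne_top.lt_top⟩
    -- Bounds the estimate on `A t i`, whose probability is at least `c * vol (A t i) / vol Θ`. For
    -- a null set both the estimate and `κ i` are `0`, by division by zero.
    let κ : Fin M → ℝ := fun i => volume.real Θ / (c * volume.real (A t i))
    have hκ : ∀ i, 0 ≤ κ i := fun i => by positivity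
    refine ⟨c * Real.exp (-lam * ∑ i, κ i), by positivity, fun h x => ?_⟩
    set w := weight Θ lam l A t (Fin.init h) with hw_def
    have hw : Measurable w := (H.measurable_weight t).comp measurable_prodMk_left
    have hw' : ∀ x, w x ∈ Set.Icc c 1 := hcw _
    have hWpos := (setIntegral_weight_pos H.volume_ne_zero H.volume_ne_top hw hc hw').2
    have hint : Integrable w (volume.restrict Θ) :=
      integrable_of_bounds hw (Filter.Eventually.of_forall hw')
    have hW : ∫ y in Θ, w y ≤ volume.real Θ := by
      calc ∫ y in Θ, w y ≤ ∫ _ in Θ, (1 : ℝ) :=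
            integral_mono hint (integrable_const _) fun x => (hw' x).2
        _ = _ := by simp
    have hterm : ∀ i, ∀ y ∈ A t i, l t y / prob Θ w (A t i) ∈ Set.Icc 0 (κ i) := by
      intro i y hy
      have hsub := (H.feedback t).subset i
      have hl := H.loss_mem t y (hsub hy)
      have hfin : volume (A t i) ≠ ⊤ := measure_ne_top_of_subset hsub H.volume_ne_top
      have hp : prob Θ w (A t i) = (∫ x in A t i, w x) / ∫ x in Θ, w x := integral_div _ _
      by_cases hz : volume (A t i) = 0
      · rw [hp, setIntegral_measure_zero _ hz]
        simpa using hκ i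
      · have h1 := (setIntegral_weight_pos hz hfin hw hc hw').1
        have hv : 0 < volume.real (A t i) := ENNReal.toReal_pos hz hfin
        have hcv : 0 < c * volume.real (A t i) := mul_pos hc hv
        have hI : 0 < ∫ x in A t i, w x := hcv.trans_le h1
        rw [hp, div_div_eq_mul_div]
        refine ⟨by have := hl.1; positivity, ?_⟩
        refine div_le_div₀ measureReal_nonneg ?_ hcv h1
        nlinarith [hl.1, hl.2]
    have hest : lossEstimate Θ w (A t) (l t) (h (Fin.last t)) x ∈ Set.Icc 0 (∑ i, κ i) := by
      classical
      rw [lossEstimate_eq_sum (H.feedback t)]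
      refine ⟨Finset.sum_nonneg fun i _ => ?_, Finset.sum_le_sum fun i _ => ?_⟩
      · split_ifs with h1 h2
        exacts [(hterm i x h2).1, le_rfl, le_rfl]
      · split_ifs with h1 h2
        exacts [(hterm i x h2).2, hκ i, hκ i]
    have he1 : Real.exp (-lam * ∑ i, κ i)
        ≤ Real.exp (-lam * lossEstimate Θ w (A t) (l t) (h (Fin.last t)) x) :=
      Real.exp_le_exp.2 (by nlinarith [hest.2])
    have he2 : Real.exp (-lam * lossEstimate Θ w (A t) (l t) (h (Fin.last t)) x) ≤ 1 :=
      Real.exp_le_one_iff.2 (by nlinarith [hest.1])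
    exact ⟨mul_le_mul (hw' x).1 he1 (Real.exp_pos _).le (hc.le.trans (hw' x).1),
      mul_le_one₀ (hw' x).2 (Real.exp_pos _).le he2⟩

theorem IsInstance.isProbabilityMeasure_playDist_weight (H : IsInstance Θ l A) (hlam : 0 ≤ lam)
    (t : ℕ) (h : Fin t → EuclideanSpace ℝ (Fin d)) :
    IsProbabilityMeasure (playDist Θ (weight Θ lam l A t h)) := by
  obtain ⟨c, hc, hcw⟩ := H.exists_weight_bound hlam t
  exact isProbabilityMeasure_playDist H.volume_ne_zero H.volume_ne_top
    ((H.measurable_weight t).comp measurable_prodMk_left) hc (hcw h)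

/-- Packages the step of `playLaw`, a bind along a bare function, as a Markov kernel, so that
composition and Fubini results for kernels apply. -/
theorem IsInstance.exists_kernel (H : IsInstance Θ l A) (hlam : 0 ≤ lam) (t : ℕ) :
    ∃ κ : ProbabilityTheory.Kernel (Fin t → EuclideanSpace ℝ (Fin d))
        (Fin (t + 1) → EuclideanSpace ℝ (Fin d)),
      ProbabilityTheory.IsMarkovKernel κ ∧
      (∀ h, κ h = (playDist Θ (weight Θ lam l A t h)).map fun x =>
        (Fin.snoc h x : Fin (t + 1) → EuclideanSpace ℝ (Fin d))) ∧
      playLaw Θ lam l A (t + 1) = (playLaw Θ lam l A t).bind κ := by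
  let κ₀ : ProbabilityTheory.Kernel (Fin t → EuclideanSpace ℝ (Fin d))
      (EuclideanSpace ℝ (Fin d)) :=
    ⟨fun h => playDist Θ (weight Θ lam l A t h), measurable_playDist (H.measurable_weight t)⟩
  have hκ₀ : ProbabilityTheory.IsMarkovKernel κ₀ :=
    ⟨H.isProbabilityMeasure_playDist_weight hlam t⟩
  let κ := (ProbabilityTheory.Kernel.prod .id κ₀).map
    fun p => (Fin.snoc p.1 p.2 : Fin (t + 1) → EuclideanSpace ℝ (Fin d))
  have hκ : ∀ h, κ h = (playDist Θ (weight Θ lam l A t h)).map fun x =>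
      (Fin.snoc h x : Fin (t + 1) → EuclideanSpace ℝ (Fin d)) := by
    intro h
    have hm := measurable_snoc t (X := EuclideanSpace ℝ (Fin d))
    have := H.isProbabilityMeasure_playDist_weight hlam t h
    rw [ProbabilityTheory.Kernel.map_apply _ hm, ProbabilityTheory.Kernel.prod_apply,
      ProbabilityTheory.Kernel.id_apply]
    change Measure.map _ ((Measure.dirac h).prod (playDist Θ (weight Θ lam l A t h))) = _
    rw [Measure.dirac_prod, Measure.map_map hm measurable_prodMk_left]
    rfl
  refine ⟨κ, ProbabilityTheory.Kernel.IsMarkovKernel.map _ (measurable_snoc t), hκ, ?_⟩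
  rw [playLaw]
  congr 1
  ext1 h
  exact (hκ h).symm

theorem IsInstance.isProbabilityMeasure_playLaw (H : IsInstance Θ l A) (hlam : 0 ≤ lam) (t : ℕ) :
    IsProbabilityMeasure (playLaw Θ lam l A t) := by
  induction t with
  | zero => exact Measure.dirac.isProbabilityMeasure
  | succ t ih =>
    obtain ⟨κ, hκ, -, heq⟩ := H.exists_kernel hlam t
    rw [heq]
    infer_instance

theorem IsInstance.playLaw_ae_mem (H : IsInstance Θ l A) (hlam : 0 ≤ lam) (t : ℕ) :
    ∀ᵐ h ∂(playLaw Θ lam l A t), ∀ i, h i ∈ Θ := by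
  induction t with
  | zero => exact Filter.Eventually.of_forall fun h i => i.elim0
  | succ t ih =>
    obtain ⟨κ, hκ, hκh, heq⟩ := H.exists_kernel hlam t
    have hm : MeasurableSet {h : Fin (t + 1) → EuclideanSpace ℝ (Fin d) | ∀ i, h i ∈ Θ} := by
      have : {h : Fin (t + 1) → EuclideanSpace ℝ (Fin d) | ∀ i, h i ∈ Θ}
          = Set.univ.pi fun _ => Θ := by ext; simp
      rw [this]
      exact MeasurableSet.univ_pi fun _ => H.measurableSet
    rw [heq]
    refine Measure.ae_comp_of_ae_ae hm (ih.mono fun h hh => ?_)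
    rw [hκh, ae_map_iff (measurable_snoc_left h).aemeasurable hm]
    refine (playDist_ae_mem H.measurableSet).mono fun x hx i => ?_
    refine Fin.lastCases ?_ (fun j => ?_) i
    · simpa using hx
    · simpa using hh j

theorem IsInstance.integral_playLaw_succ (H : IsInstance Θ l A) (hlam : 0 ≤ lam) (t : ℕ)
    {F : (Fin (t + 1) → EuclideanSpace ℝ (Fin d)) → ℝ} (hF : Measurable F)
    (hFi : Integrable F (playLaw Θ lam l A (t + 1))) :
    Integrable (fun h => ∫ x, F (Fin.snoc h x) ∂(playDist Θ (weight Θ lam l A t h)))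
        (playLaw Θ lam l A t) ∧
      ∫ h, F h ∂(playLaw Θ lam l A (t + 1))
        = ∫ h, ∫ x, F (Fin.snoc h x) ∂(playDist Θ (weight Θ lam l A t h))
            ∂(playLaw Θ lam l A t) := by
  obtain ⟨κ, hκ, hκh, heq⟩ := H.exists_kernel hlam t
  have hinner : ∀ h, ∫ y, F y ∂(κ h)
      = ∫ x, F (Fin.snoc h x) ∂(playDist Θ (weight Θ lam l A t h)) := by
    intro h
    rw [hκh, integral_map (measurable_snoc_left h).aemeasurable
      hF.aestronglyMeasurable]
  -- The law of the past is read as a constant kernel, which turns the claim into the integral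
  -- formula for a composition of kernels.
  rw [heq, Measure.comp_eq_comp_const_apply] at hFi
  rw [heq, Measure.comp_eq_comp_const_apply]
  have h1 := hFi.integral_comp
  have h2 := ProbabilityTheory.Kernel.integral_comp hFi
  simp only [hinner, ProbabilityTheory.Kernel.const_apply] at h1 h2
  exact ⟨h1, h2⟩

end Instance

/-! ### Regret against the uniform distribution on a subset -/

section Regret

variable {d M : ℕ} {Θ : Set (EuclideanSpace ℝ (Fin d))} {l : ℕ → EuclideanSpace ℝ (Fin d) → ℝ}
  {A : ℕ → Fin M → Set (EuclideanSpace ℝ (Fin d))} {lam : ℝ}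

theorem IsInstance.integrable_regret (H : IsInstance Θ l A) (hlam : 0 ≤ lam) (T : ℕ)
    (ρstar : EuclideanSpace ℝ (Fin d)) :
    Integrable (fun h => ∑ t : Fin T, (l t (h t) - l t ρstar)) (playLaw Θ lam l A T) := by
  have := H.isProbabilityMeasure_playLaw hlam T
  refine integrable_finsetSum _ fun t _ => Integrable.sub ?_ (integrable_const _)
  exact integrable_of_bounds ((H.measurable_loss t).comp (measurable_pi_apply t))
    ((H.playLaw_ae_mem hlam T).mono fun h hh => H.loss_mem t _ (hh t))

theorem IsInstance.condRegret_le_card (H : IsInstance Θ l A) (hlam : 0 ≤ lam) (T : ℕ)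
    {ρstar : EuclideanSpace ℝ (Fin d)} (hρ : ρstar ∈ Θ) : condRegret Θ lam l A T ρstar ≤ T := by
  have := H.isProbabilityMeasure_playLaw hlam T
  calc condRegret Θ lam l A T ρstar ≤ ∫ _, (T : ℝ) ∂(playLaw Θ lam l A T) := by
        refine integral_mono_ae (H.integrable_regret hlam T ρstar) (integrable_const _) ?_
        filter_upwards [H.playLaw_ae_mem hlam T] with h hh
        calc ∑ t : Fin T, (l t (h t) - l t ρstar) ≤ ∑ _t : Fin T, (1 : ℝ) :=
              Finset.sum_le_sum fun t _ => by
                linarith [(H.loss_mem t _ (hh t)).2, (H.loss_mem t _ hρ).1]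
          _ = T := by simp
    _ = T := by simp

theorem IsInstance.integrable_integral_loss (H : IsInstance Θ l A) (hlam : 0 ≤ lam) (T : ℕ) :
    Integrable (fun h => ∫ x, l T x ∂(playDist Θ (weight Θ lam l A T h))) (playLaw Θ lam l A T) := by
  have := H.isProbabilityMeasure_playLaw hlam (T + 1)
  have hm : Measurable fun h : Fin (T + 1) → EuclideanSpace ℝ (Fin d) => l T (h (Fin.last T)) :=
    (H.measurable_loss T).comp (measurable_pi_apply _)
  have hi := (H.integral_playLaw_succ hlam T hm (integrable_of_bounds hm
    ((H.playLaw_ae_mem hlam (T + 1)).mono fun h hh => H.loss_mem T _ (hh _)))).1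
  simpa using hi

theorem IsInstance.condRegret_succ (H : IsInstance Θ l A) (hlam : 0 ≤ lam) (T : ℕ)
    (ρstar : EuclideanSpace ℝ (Fin d)) :
    condRegret Θ lam l A (T + 1) ρstar = condRegret Θ lam l A T ρstar
      + ∫ h, ∫ x, l T x ∂(playDist Θ (weight Θ lam l A T h)) ∂(playLaw Θ lam l A T)
      - l T ρstar := by
  have := H.isProbabilityMeasure_playLaw hlam T
  have hm : Measurable fun h : Fin (T + 1) → EuclideanSpace ℝ (Fin d) =>
      ∑ t : Fin (T + 1), (l t (h t) - l t ρstar) :=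
    Finset.measurable_sum _ fun t _ =>
      ((H.measurable_loss t).comp (measurable_pi_apply t)).sub_const _
  rw [condRegret, (H.integral_playLaw_succ hlam T hm (H.integrable_regret hlam (T + 1) ρstar)).2]
  have hin : ∀ h : Fin T → EuclideanSpace ℝ (Fin d),
      ∫ x, ∑ t : Fin (T + 1), (l t ((Fin.snoc h x : Fin (T + 1) → EuclideanSpace ℝ (Fin d)) t)
        - l t ρstar) ∂(playDist Θ (weight Θ lam l A T h))
      = ∑ t : Fin T, (l t (h t) - l t ρstar)
        + (∫ x, l T x ∂(playDist Θ (weight Θ lam l A T h)) - l T ρstar) := by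
    intro h
    have := H.isProbabilityMeasure_playDist_weight hlam T h
    have hli : Integrable (l T) (playDist Θ (weight Θ lam l A T h)) :=
      integrable_of_bounds (H.measurable_loss T)
        ((playDist_ae_mem H.measurableSet).mono (H.loss_mem T))
    simp only [Fin.sum_univ_castSucc, Fin.snoc_castSucc, Fin.snoc_last, Fin.val_castSucc,
      Fin.val_last]
    rw [integral_add (g := fun x => l T x - l T ρstar) (integrable_const _)
        (hli.sub (integrable_const _)),
      integral_sub hli (integrable_const _)]
    simp
  simp only [hin]
  have hJ := H.integrable_integral_loss hlam T
  rw [integral_add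
      (g := fun h => ∫ x, l T x ∂(playDist Θ (weight Θ lam l A T h)) - l T ρstar)
      (H.integrable_regret hlam T ρstar) (hJ.sub (integrable_const _)),
    integral_sub hJ (integrable_const _)]
  simp only [integral_const, probReal_univ, one_smul, condRegret]
  ring

variable {ν : Measure (EuclideanSpace ℝ (Fin d))} [IsProbabilityMeasure ν]

theorem IsInstance.integrable_potential (H : IsInstance Θ l A) (hlam : 0 ≤ lam) (T : ℕ) :
    Integrable (fun h => potential Θ ν (weight Θ lam l A T h)) (playLaw Θ lam l A T) := by
  have := H.isProbabilityMeasure_playLaw hlam T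
  have : Fact (volume Θ < ⊤) := ⟨H.volume_ne_top.lt_top⟩
  obtain ⟨c, hc, hcw⟩ := H.exists_weight_bound hlam T
  refine integrable_of_bounds (measurable_potential (H.measurable_weight T))
    (a := Real.log (c * volume.real Θ)) (b := Real.log (volume.real Θ) - Real.log c)
    (Filter.Eventually.of_forall fun h => ?_)
  have hw : Measurable (weight Θ lam l A T h) :=
    (H.measurable_weight T).comp measurable_prodMk_left
  have hv : 0 < volume.real Θ := ENNReal.toReal_pos H.volume_ne_zero H.volume_ne_top
  obtain ⟨h1, h2⟩ :=
    setIntegral_weight_pos H.volume_ne_zero H.volume_ne_top hw hc (hcw h)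
  have h3 : ∫ x in Θ, weight Θ lam l A T h x ≤ volume.real Θ := by
    calc ∫ x in Θ, weight Θ lam l A T h x ≤ ∫ _ in Θ, (1 : ℝ) :=
          integral_mono (integrable_of_bounds hw (Filter.Eventually.of_forall (hcw h)))
            (integrable_const _) fun x => (hcw h x).2
      _ = _ := by simp
  have hlog : ∀ x, Real.log (weight Θ lam l A T h x) ∈ Set.Icc (Real.log c) 0 := fun x =>
    ⟨Real.log_le_log hc (hcw h x).1,
      Real.log_nonpos (hc.le.trans (hcw h x).1) (hcw h x).2⟩
  have h4 : ∫ x, Real.log (weight Θ lam l A T h x) ∂ν ≤ 0 :=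
    integral_nonpos fun x => (hlog x).2
  have h5 : Real.log c ≤ ∫ x, Real.log (weight Θ lam l A T h x) ∂ν := by
    calc Real.log c = ∫ _, Real.log c ∂ν := by simp
      _ ≤ _ := integral_mono (integrable_const _) (integrable_of_bounds
        (Real.measurable_log.comp hw) (Filter.Eventually.of_forall hlog)) fun x => (hlog x).1
  have h6 := Real.log_le_log (mul_pos hc hv) h1
  have h7 := Real.log_le_log h2 h3
  simp only [potential]
  exact ⟨by linarith, by linarith⟩

/-- The potential argument: the expected potential after `T` rounds controls the regret against the
average loss under `ν`. -/
theorem IsInstance.regret_add_potential_le (H : IsInstance Θ l A) (hlam : 0 ≤ lam)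
    (hν : ∀ᵐ x ∂ν, x ∈ Θ) (ρstar : EuclideanSpace ℝ (Fin d)) (T : ℕ) :
    lam * condRegret Θ lam l A T ρstar
        + ∫ h, potential Θ ν (weight Θ lam l A T h) ∂(playLaw Θ lam l A T)
      ≤ Real.log (volume.real Θ) + lam ^ 2 * M * T / 2
        + lam * ∑ t ∈ Finset.range T, (∫ x, l t x ∂ν - l t ρstar) := by
  induction T with
  | zero =>
    simp [condRegret, potential, playLaw, weight]
  | succ T ih =>
    have := H.isProbabilityMeasure_playLaw hlam T
    have hJ := H.integrable_integral_loss hlam T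
    have hpot := H.integrable_potential (ν := ν) hlam T
    obtain ⟨hi, heq⟩ := H.integral_playLaw_succ hlam T
      (measurable_potential (H.measurable_weight (T + 1)))
      (H.integrable_potential (ν := ν) hlam (T + 1))
    simp only [weight_snoc] at hi heq
    obtain ⟨c, hc, hcw⟩ := H.exists_weight_bound hlam T
    have hmono : ∫ h, potential Θ ν (weight Θ lam l A (T + 1) h) ∂(playLaw Θ lam l A (T + 1))
        ≤ ∫ h, (potential Θ ν (weight Θ lam l A T h)
            - lam * (∫ x, l T x ∂(playDist Θ (weight Θ lam l A T h)))
            + (lam ^ 2 * M / 2 + lam * ∫ x, l T x ∂ν)) ∂(playLaw Θ lam l A T) := by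
      rw [heq]
      refine integral_mono hi ((hpot.sub (hJ.const_mul _)).add (integrable_const _)) fun h => ?_
      have := integral_potential_updateWeight_le H.measurableSet H.volume_ne_zero H.volume_ne_top
        ((H.measurable_weight T).comp measurable_prodMk_left) hc (hcw h) (H.feedback T)
        (H.measurable_loss T) (H.loss_mem T) hlam hν
      simp only [← add_assoc]
      exact this
    rw [integral_add (f := fun h => potential Θ ν (weight Θ lam l A T h)
          - lam * (∫ x, l T x ∂(playDist Θ (weight Θ lam l A T h))))
        (hpot.sub (hJ.const_mul _)) (integrable_const _),
      integral_sub hpot (hJ.const_mul _), integral_const_mul] at hmono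
    simp only [integral_const, probReal_univ, one_smul] at hmono
    rw [H.condRegret_succ hlam, Finset.sum_range_succ]
    push_cast
    linarith

/-- Jensen's inequality for the weight of a subset `B` of `Θ`. -/
theorem log_volume_le_potential (hfin : volume Θ ≠ ⊤)
    {w : EuclideanSpace ℝ (Fin d) → ℝ} {c : ℝ}
    (hw : Measurable w) (hc : 0 < c) (hcw : ∀ x, w x ∈ Set.Icc c 1)
    {B : Set (EuclideanSpace ℝ (Fin d))} (hBΘ : B ⊆ Θ) (hB : volume B ≠ 0) :
    Real.log (volume.real B) ≤ potential Θ (ProbabilityTheory.cond volume B) w := by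
  have hBfin : volume B ≠ ⊤ := measure_ne_top_of_subset hBΘ hfin
  have : Fact (volume Θ < ⊤) := ⟨hfin.lt_top⟩
  have : Fact (volume B < ⊤) := ⟨hBfin.lt_top⟩
  have hprob : IsProbabilityMeasure (ProbabilityTheory.cond volume B) :=
    ProbabilityTheory.cond_isProbabilityMeasure_of_finite hB hBfin
  have hv : 0 < volume.real B := ENNReal.toReal_pos hB hBfin
  have hlog : ∀ x, Real.log (w x) ∈ Set.Icc (Real.log c) 0 := fun x =>
    ⟨Real.log_le_log hc (hcw x).1, Real.log_nonpos (hc.le.trans (hcw x).1) (hcw x).2⟩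
  have h1 : ∫ x, Real.log (w x) ∂(ProbabilityTheory.cond volume B)
      ≤ Real.log (∫ x, w x ∂(ProbabilityTheory.cond volume B)) := by
    -- Jensen is applied on a closed set where `log` is continuous; the lower bound `c` on the
    -- weights provides one.
    have hconc : ConcaveOn ℝ (Set.Ici c) Real.log :=
      strictConcaveOn_log_Ioi.concaveOn.subset (fun x hx => hc.trans_le hx) (convex_Ici c)
    exact hconc.le_map_integral
      (Real.continuousOn_log.mono fun x hx => (hc.trans_le hx).ne') isClosed_Ici
      (Filter.Eventually.of_forall fun x => (hcw x).1)
      (integrable_of_bounds hw (Filter.Eventually.of_forall hcw))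
      (integrable_of_bounds (Real.measurable_log.comp hw) (Filter.Eventually.of_forall hlog))
  have h2 : ∫ x, w x ∂(ProbabilityTheory.cond volume B) = (volume.real B)⁻¹ * ∫ x in B, w x := by
    rw [ProbabilityTheory.cond, integral_smul_measure, smul_eq_mul, ENNReal.toReal_inv]
    rfl
  have h3 := (setIntegral_weight_pos hB hBfin hw hc hcw).2
  have h4 : ∫ x in B, w x ≤ ∫ x in Θ, w x :=
    setIntegral_mono_set (integrable_of_bounds hw (Filter.Eventually.of_forall hcw))
      (Filter.Eventually.of_forall fun x => hc.le.trans (hcw x).1)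
      (Filter.Eventually.of_forall hBΘ)
  rw [h2, Real.log_mul (inv_pos.2 hv).ne' h3.ne', Real.log_inv] at h1
  have h5 := Real.log_le_log h3 h4
  simp only [potential]
  linarith

/-- The expected potential for the uniform distribution on `B` is squeezed between Jensen's lower
bound and the upper bound involving the regret; then divide by `lam`. -/
theorem IsInstance.condRegret_le_of_subset (H : IsInstance Θ l A) (hlam : 0 < lam)
    {B : Set (EuclideanSpace ℝ (Fin d))} (hBm : MeasurableSet B) (hBΘ : B ⊆ Θ)
    (hB : volume B ≠ 0) (T : ℕ) {ρstar : EuclideanSpace ℝ (Fin d)} {b : ℝ}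
    (hb : ∀ x ∈ B, ∑ t ∈ Finset.range T, (l t x - l t ρstar) ≤ b) :
    condRegret Θ lam l A T ρstar
      ≤ (Real.log (volume.real Θ) - Real.log (volume.real B)) / lam + lam * M * T / 2 + b := by
  have hBfin : volume B ≠ ⊤ := measure_ne_top_of_subset hBΘ H.volume_ne_top
  have hprob : IsProbabilityMeasure (ProbabilityTheory.cond volume B) :=
    ProbabilityTheory.cond_isProbabilityMeasure_of_finite hB hBfin
  have hνB : ∀ᵐ x ∂(ProbabilityTheory.cond volume B), x ∈ B := by
    exact ProbabilityTheory.ae_cond_mem hBm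
  have hν : ∀ᵐ x ∂(ProbabilityTheory.cond volume B), x ∈ Θ := hνB.mono fun x hx => hBΘ hx
  have := H.isProbabilityMeasure_playLaw hlam.le T
  obtain ⟨c, hc, hcw⟩ := H.exists_weight_bound hlam.le T
  have h1 := H.regret_add_potential_le hlam.le hν ρstar T
  have h2 : Real.log (volume.real B) ≤ ∫ h, potential Θ (ProbabilityTheory.cond volume B)
      (weight Θ lam l A T h) ∂(playLaw Θ lam l A T) := by
    calc Real.log (volume.real B)
        = ∫ _, Real.log (volume.real B) ∂(playLaw Θ lam l A T) := by simp
      _ ≤ _ := integral_mono (integrable_const _) (H.integrable_potential hlam.le T) fun h =>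
        log_volume_le_potential H.volume_ne_top
          ((H.measurable_weight T).comp measurable_prodMk_left) hc (hcw h) hBΘ hB
  have hli : ∀ t, Integrable (fun x => l t x - l t ρstar) (ProbabilityTheory.cond volume B) :=
    fun t => (integrable_of_bounds (H.measurable_loss t) (hν.mono (H.loss_mem t))).sub
      (integrable_const _)
  have h3 : ∑ t ∈ Finset.range T, (∫ x, l t x ∂(ProbabilityTheory.cond volume B) - l t ρstar)
      ≤ b := by
    have h4 : ∀ t, ∫ x, l t x ∂(ProbabilityTheory.cond volume B) - l t ρstar
        = ∫ x, (l t x - l t ρstar) ∂(ProbabilityTheory.cond volume B) := by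
      intro t
      rw [integral_sub (integrable_of_bounds (H.measurable_loss t) (hν.mono (H.loss_mem t)))
        (integrable_const _)]
      simp
    simp only [h4]
    rw [← integral_finsetSum _ fun t _ => hli t]
    calc _ ≤ ∫ _, b ∂(ProbabilityTheory.cond volume B) :=
          integral_mono_ae (integrable_finsetSum _ fun t _ => hli t) (integrable_const _)
            (hνB.mono hb)
      _ = b := by simp
  have h5 := mul_le_mul_of_nonneg_left h3 hlam.le
  have h6 : lam * condRegret Θ lam l A T ρstar
      ≤ lam * ((Real.log (volume.real Θ) - Real.log (volume.real B)) / lam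
        + lam * M * T / 2 + b) := by
    rw [mul_add, mul_add, mul_div_cancel₀ _ hlam.ne']
    linarith
  exact le_of_mul_le_mul_left h6 hlam

end Regret

/-! ### Loss and volume of a small ball -/

section Dispersion

variable {d : ℕ} {Θ : Set (EuclideanSpace ℝ (Fin d))}

/-- A loss that is Lipschitz on the ball varies by at most `L * ε` from the center; any other loss
varies by at most `1`. -/
theorem sum_sub_le_of_mem_ball {l : ℕ → EuclideanSpace ℝ (Fin d) → ℝ}
    (hl : ∀ t, ∀ x ∈ Θ, l t x ∈ Set.Icc (0 : ℝ) 1) (L : ℝ≥0) (T : ℕ)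
    {ρ x : EuclideanSpace ℝ (Fin d)} {ε : ℝ} (hε : 0 < ε) (hsub : Metric.ball ρ ε ⊆ Θ)
    (hx : x ∈ Metric.ball ρ ε) :
    ∑ t ∈ Finset.range T, (l t x - l t ρ) ≤ L * (T * ε) + nonLipschitzCount L l T ρ ε := by
  classical
  have hρ : ρ ∈ Metric.ball ρ ε := Metric.mem_ball_self hε
  have hterm : ∀ t, l t x - l t ρ
      ≤ L * ε + if ¬ LipschitzOnWith L (l t) (Metric.ball ρ ε) then 1 else 0 := by
    intro t
    by_cases h : LipschitzOnWith L (l t) (Metric.ball ρ ε)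
    · have h1 := h.dist_le_mul x hx ρ hρ
      rw [Real.dist_eq] at h1
      have h2 : (L : ℝ) * dist x ρ ≤ L * ε :=
        mul_le_mul_of_nonneg_left (Metric.mem_ball.1 hx).le L.2
      simp only [h, not_true_eq_false, if_false, add_zero]
      linarith [le_abs_self (l t x - l t ρ)]
    · simp only [h, not_false_eq_true, if_true]
      have : 0 ≤ (L : ℝ) * ε := by positivity
      linarith [(hl t x (hsub hx)).2, (hl t ρ (hsub hρ)).1]
  refine (Finset.sum_le_sum fun t _ => hterm t).trans_eq ?_
  rw [Finset.sum_add_distrib, Finset.sum_boole, nonLipschitzCount]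
  simp only [Finset.sum_const, Finset.card_range, nsmul_eq_mul]
  congr 1
  ring

/-- The volume ratio is at most `(R / ε) ^ d`; this is where the dimension enters the regret. -/
theorem log_volume_sub_log_volume_ball_le (hd : 0 < d) {c ρ : EuclideanSpace ℝ (Fin d)} {R ε : ℝ}
    (hε : 0 < ε) (hsub : Metric.ball ρ ε ⊆ Θ) (hΘ : Θ ⊆ Metric.closedBall c R) :
    Real.log (volume.real Θ) - Real.log (volume.real (Metric.ball ρ ε))
      ≤ d * (Real.log R - Real.log ε) := by
  have : Nonempty (Fin d) := ⟨⟨0, hd⟩⟩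
  have hR0 : 0 ≤ R := by
    have h1 := hΘ (hsub (Metric.mem_ball_self hε))
    exact dist_nonneg.trans (Metric.mem_closedBall.1 h1)
  set v := volume.real (Metric.ball (0 : EuclideanSpace ℝ (Fin d)) 1) with hv_def
  have hball : volume.real (Metric.ball ρ ε) = ε ^ d * v := by
    rw [← Measure.addHaar_real_closedBall_eq_addHaar_real_ball,
      Measure.addHaar_real_closedBall _ _ hε.le, finrank_euclideanSpace_fin]
  have hcball : volume.real (Metric.closedBall c R) = R ^ d * v := by
    rw [Measure.addHaar_real_closedBall _ _ hR0, finrank_euclideanSpace_fin]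
  have hv : 0 < v := ENNReal.toReal_pos (Metric.measure_ball_pos _ _ one_pos).ne'
    measure_ball_lt_top.ne
  have hcfin : volume (Metric.closedBall c R) ≠ ⊤ := measure_closedBall_lt_top.ne
  have h1 : volume.real (Metric.ball ρ ε) ≤ volume.real Θ :=
    measureReal_mono hsub (measure_ne_top_of_subset hΘ hcfin)
  have h2 : volume.real Θ ≤ volume.real (Metric.closedBall c R) := measureReal_mono hΘ hcfin
  have h3 : 0 < volume.real (Metric.ball ρ ε) := by rw [hball]; positivity
  have hR : 0 < R := by
    refine hR0.lt_of_ne fun h => ?_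
    have h4 := (h3.trans_le h1).trans_le h2
    rw [hcball, ← h, zero_pow hd.ne', zero_mul] at h4
    exact lt_irrefl _ h4
  have h5 := Real.log_le_log (h3.trans_le h1) h2
  rw [hcball, Real.log_mul (by positivity) hv.ne', Real.log_pow] at h5
  rw [hball, Real.log_mul (by positivity) hv.ne', Real.log_pow]
  linarith

end Dispersion

/-- The step size `√(d / T)`, truncated at `1`. -/
noncomputable def stepSize (d T : ℕ) : ℝ := min 1 (Real.sqrt (d / T))

theorem stepSize_mem (d T : ℕ) : stepSize d T ∈ Set.Icc (0 : ℝ) 1 :=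
  ⟨le_min zero_le_one (Real.sqrt_nonneg _), min_le_left _ _⟩

/-- Dimension zero is separate, since there the step size vanishes; but the space is a single point.
-/
theorem condRegret_eq_zero {M : ℕ} (Θ : Set (EuclideanSpace ℝ (Fin 0))) (lam : ℝ)
    (l : ℕ → EuclideanSpace ℝ (Fin 0) → ℝ) (A : ℕ → Fin M → Set (EuclideanSpace ℝ (Fin 0)))
    (T : ℕ) (ρstar : EuclideanSpace ℝ (Fin 0)) : condRegret Θ lam l A T ρstar = 0 := by
  have h : ∀ h : Fin T → EuclideanSpace ℝ (Fin 0),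
      ∑ t : Fin T, (l t (h t) - l t ρstar) = 0 := fun h =>
    Finset.sum_eq_zero fun t _ => by rw [Subsingleton.elim (h t) ρstar, sub_self]
  simp [condRegret, h]

/-! ### The bound for the tuned step size -/

section Bound

variable {d M : ℕ} {Θ : Set (EuclideanSpace ℝ (Fin d))} {l : ℕ → EuclideanSpace ℝ (Fin d) → ℝ}
  {A : ℕ → Fin M → Set (EuclideanSpace ℝ (Fin d))}

/-- For `d ≤ T` the truncation of the step size is inactive, so `d / lam` and `lam * T` both equal
`√(d * T)`. -/
theorem IsInstance.condRegret_stepSize_le (H : IsInstance Θ l A) (hd : 0 < d) {T : ℕ}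
    (hdT : d ≤ T) {c : EuclideanSpace ℝ (Fin d)} {R : ℝ} (hΘ : Θ ⊆ Metric.closedBall c R)
    (L : ℝ≥0) (β : ℝ) {ρ ρstar : EuclideanSpace ℝ (Fin d)}
    (hρ : IsBestInHindsight Θ l T ρ) (hρstar : ρstar ∈ Θ)
    (hsub : Metric.ball ρ ((T : ℝ) ^ (-β)) ⊆ Θ) :
    condRegret Θ (stepSize d T) l A T ρstar
      ≤ (|Real.log R| + |β| + M) * (1 + Real.log T) * Real.sqrt (d * T)
        + L * (T : ℝ) ^ (1 - β) + nonLipschitzCount L l T ρ ((T : ℝ) ^ (-β)) := by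
  have hd' : (0 : ℝ) < d := by exact_mod_cast hd
  have hT : (0 : ℝ) < T := by exact_mod_cast hd.trans_le hdT
  have hT1 : (1 : ℝ) ≤ T := by exact_mod_cast hd.trans_le hdT
  set ε := (T : ℝ) ^ (-β) with hε_def
  have hε : 0 < ε := Real.rpow_pos_of_pos hT _
  have hlogε : Real.log ε = -β * Real.log T := Real.log_rpow hT _
  have hlogT : 0 ≤ Real.log T := Real.log_nonneg hT1
  have hTε : (T : ℝ) ^ (1 - β) = T * ε := by
    rw [sub_eq_add_neg, Real.rpow_add hT, Real.rpow_one]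
  have hlam : stepSize d T = Real.sqrt (d / T) := by
    refine min_eq_right (Real.sqrt_le_one.2 ?_)
    exact (div_le_one hT).2 (by exact_mod_cast hdT)
  have hlam0 : 0 < stepSize d T := by rw [hlam]; exact Real.sqrt_pos.2 (by positivity)
  have hlamT : stepSize d T * T = Real.sqrt (d * T) := by
    rw [hlam, ← Real.sqrt_sq hT.le, ← Real.sqrt_mul (by positivity), Real.sqrt_sq hT.le]
    congr 1
    field_simp
  have hdlam : d / stepSize d T = Real.sqrt (d * T) := by
    rw [div_eq_iff hlam0.ne', hlam, ← Real.sqrt_mul (by positivity)]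
    have : (d : ℝ) * T * (d / T) = d ^ 2 := by field_simp
    rw [this, Real.sqrt_sq hd'.le]
  set S := Real.sqrt (d * T) with hS_def
  have hS : 0 ≤ S := Real.sqrt_nonneg _
  have hmain := H.condRegret_le_of_subset hlam0 measurableSet_ball hsub
    (Metric.measure_ball_pos _ _ hε).ne' T (ρstar := ρstar)
    (b := L * (T * ε) + nonLipschitzCount L l T ρ ε) fun x hx => by
      have h1 := sum_sub_le_of_mem_ball H.loss_mem L T hε hsub hx
      -- The ball is centered at the interior minimizer `ρ`, while the regret is measured against a
      -- possibly different `ρstar`; minimality of `ρ` bridges the two.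
      have h2 : ∑ t ∈ Finset.range T, l t ρ ≤ ∑ t ∈ Finset.range T, l t ρstar :=
        isMinOn_iff.1 hρ.2 ρstar hρstar
      rw [Finset.sum_sub_distrib] at h1 ⊢
      linarith
  have hvol : (Real.log (volume.real Θ) - Real.log (volume.real (Metric.ball ρ ε)))
      / stepSize d T ≤ (Real.log R + β * Real.log T) * S := by
    have h1 := log_volume_sub_log_volume_ball_le hd hε hsub hΘ
    rw [hlogε] at h1
    calc _ ≤ d * (Real.log R - -β * Real.log T) / stepSize d T := by gcongr
      _ = (Real.log R + β * Real.log T) * (d / stepSize d T) := by ring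
      _ = _ := by rw [hdlam]
  have hcoef : Real.log R + β * Real.log T + M / 2
      ≤ (|Real.log R| + |β| + M) * (1 + Real.log T) := by
    have h1 : β * Real.log T ≤ |β| * Real.log T := by gcongr; exact le_abs_self β
    have h2 := le_abs_self (Real.log R)
    have h3 : 0 ≤ |Real.log R| * Real.log T := by positivity
    have h4 : 0 ≤ (M : ℝ) * Real.log T := by positivity
    have h5 : (0 : ℝ) ≤ M := by positivity
    nlinarith [abs_nonneg β]
  have hfin := mul_le_mul_of_nonneg_right hcoef hS
  have h6 : stepSize d T * M * T / 2 = M / 2 * S := by rw [← hlamT]; ring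
  rw [hTε]
  rw [h6] at hmain
  linarith

end Bound

end Exp3Set

/-! ### Averaging over the adversary's draw -/

theorem mainTheorem2 (M : ℕ) (L : ℝ≥0) (R β : ℝ) :
    ∃ lam : ℕ → ℕ → ℝ, (∀ d T, lam d T ∈ Set.Icc (0 : ℝ) 1) ∧
      ∀ (r₀ : ℝ), 0 < r₀ → ∀ (D : ℝ) (q : ℕ), ∃ (C : ℝ) (k : ℕ),
        ∀ (d : ℕ) (Θ : Set (EuclideanSpace ℝ (Fin d))),
          MeasurableSet Θ → (∃ c, Θ ⊆ Metric.closedBall c R) →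
        ∀ (Ω : Type*) [MeasurableSpace Ω] (μ : Measure Ω) [IsProbabilityMeasure μ]
          (l : ℕ → Ω → EuclideanSpace ℝ (Fin d) → ℝ)
          (A : ℕ → Ω → Fin M → Set (EuclideanSpace ℝ (Fin d))),
          (∀ t, Measurable (Function.uncurry (l t))) →
          (∀ t ω, ∀ x ∈ Θ, l t ω x ∈ Set.Icc (0 : ℝ) 1) →
          (∀ t ω, Exp3Set.PiecewiseLipschitzOn L (l t ω) Θ) →
          (∀ t i, MeasurableSet {p : Ω × EuclideanSpace ℝ (Fin d) | p.2 ∈ A t p.1 i}) →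
          (∀ t ω, Exp3Set.IsFeedbackSystem Θ (A t ω)) →
          Exp3Set.IsBetaDispersed μ Θ L l β D q →
          Exp3Set.HasInteriorMinimizer μ Θ l r₀ →
        ∀ T : ℕ, 1 ≤ T → ∀ ρstar : Ω → EuclideanSpace ℝ (Fin d),
          (∀ᵐ ω ∂μ, Exp3Set.IsBestInHindsight Θ (fun t => l t ω) T (ρstar ω)) →
          Exp3Set.expectedRegret μ Θ (lam d T) l A T ρstar
            ≤ ENNReal.ofReal (C * (1 + Real.log T) ^ k *
                (Real.sqrt (d * T) + (T : ℝ) ^ (1 - β))) := by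
  -- `1 + 1 / r₀` pays for the regimes with the trivial bound, `|D|` for dispersion, `L` for
  -- Lipschitz rounds, and the rest for volume and variance. The power `q + 1` covers both `Λ` and
  -- `Λ ^ q`.
  refine ⟨Exp3Set.stepSize, Exp3Set.stepSize_mem, fun r₀ hr₀ D q =>
    ⟨1 + 1 / r₀ + |D| + L + (|Real.log R| + |β| + M), q + 1, ?_⟩⟩
  rintro d Θ hΘ ⟨c, hc⟩ Ω _ μ _ l A hlm hl01 - - hA hdisp hint T hT ρstar hρstar
  have hT1 : (1 : ℝ) ≤ T := by exact_mod_cast hT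
  have hT0 : (0 : ℝ) < T := by linarith
  have hr₀' : 0 < 1 / r₀ := by positivity
  have hlogT : 0 ≤ Real.log T := Real.log_nonneg hT1
  set Λ := 1 + Real.log T with hΛ_def
  have hΛ : 1 ≤ Λ := by linarith
  have hΛ0 : 0 ≤ Λ := by linarith
  have hΛq1 : 1 ≤ Λ ^ (q + 1) := one_le_pow₀ hΛ
  have hL : (0 : ℝ) ≤ L := L.2
  set S := Real.sqrt (d * T) with hS_def
  have hS : 0 ≤ S := Real.sqrt_nonneg _
  set P := (T : ℝ) ^ (1 - β) with hP_def
  have hP : 0 ≤ P := Real.rpow_nonneg hT0.le _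
  set C₁ := |Real.log R| + |β| + (M : ℝ) with hC₁_def
  have hC₁ : 0 ≤ C₁ := by positivity
  rcases Nat.eq_zero_or_pos d with rfl | hd
  · simp [Exp3Set.expectedRegret, Exp3Set.condRegret_eq_zero]
  have hfin : volume Θ ≠ ⊤ := measure_ne_top_of_subset hc measure_closedBall_lt_top.ne
  -- An interior minimizer, here for zero rounds, places a ball of radius `r₀` inside `Θ`.
  have hvol : volume Θ ≠ 0 := by
    obtain ⟨ω, hω⟩ := hint.exists
    obtain ⟨ρ, -, hρ⟩ := hω 0
    exact ((Metric.measure_ball_pos volume ρ hr₀).trans_le (measure_mono hρ)).ne'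
  have H : ∀ ω, Exp3Set.IsInstance Θ (fun t => l t ω) (fun t => A t ω) := fun ω =>
    ⟨hΘ, hvol, hfin, fun t => (hlm t).comp measurable_prodMk_left, fun t => hl01 t ω,
      fun t => hA t ω⟩
  have htriv : (T : ℝ) ≤ (1 + 1 / r₀) * (S + P) →
      Exp3Set.expectedRegret μ Θ (Exp3Set.stepSize d T) l A T ρstar
        ≤ ENNReal.ofReal ((1 + 1 / r₀ + |D| + L + C₁) * Λ ^ (q + 1) * (S + P)) := by
    intro h
    calc Exp3Set.expectedRegret μ Θ (Exp3Set.stepSize d T) l A T ρstar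
        ≤ ∫⁻ _, ENNReal.ofReal T ∂μ := by
          refine lintegral_mono_ae (hρstar.mono fun ω hω => ENNReal.ofReal_le_ofReal ?_)
          exact (H ω).condRegret_le_card (Exp3Set.stepSize_mem d T).1 T hω.1
      _ = ENNReal.ofReal T := by simp
      _ ≤ _ := by
        refine ENNReal.ofReal_le_ofReal (h.trans ?_)
        refine mul_le_mul_of_nonneg_right ?_ (by positivity)
        have h1 : 1 + 1 / r₀ ≤ 1 + 1 / r₀ + |D| + L + C₁ := by linarith [abs_nonneg D]
        nlinarith
  rcases le_or_gt T d with hdT | hdT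
  · refine htriv ?_
    have h1 : (T : ℝ) ≤ S := by
      refine Real.le_sqrt_of_sq_le ?_
      have : (T : ℝ) ≤ d := by exact_mod_cast hdT
      nlinarith
    nlinarith
  have hTε : P = T * (T : ℝ) ^ (-β) := by
    rw [hP_def, sub_eq_add_neg, Real.rpow_add hT0, Real.rpow_one]
  rcases lt_or_ge r₀ ((T : ℝ) ^ (-β)) with hr | hr
  · refine htriv ?_
    have h1 : (T : ℝ) ≤ 1 / r₀ * P := by
      rw [hTε, one_div, inv_mul_eq_div, le_div_iff₀ hr₀]
      gcongr
    nlinarith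
  have hε : 0 < (T : ℝ) ^ (-β) := Real.rpow_pos_of_pos hT0 _
  -- The interior minimizer depends on the draw, with no measurable choice available. Passing to the
  -- supremum over all admissible centers avoids one.
  calc Exp3Set.expectedRegret μ Θ (Exp3Set.stepSize d T) l A T ρstar
      ≤ ∫⁻ ω, (ENNReal.ofReal (C₁ * Λ * S + L * P)
          + ⨆ ρ ∈ {ρ | ρ ∈ Θ ∧ Metric.ball ρ ((T : ℝ) ^ (-β)) ⊆ Θ},
            (Exp3Set.nonLipschitzCount L (fun t => l t ω) T ρ ((T : ℝ) ^ (-β)) : ℝ≥0∞)) ∂μ := by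
        refine lintegral_mono_ae ?_
        filter_upwards [hint, hρstar] with ω hω hωstar
        obtain ⟨ρ, hρ, hball⟩ := hω T
        have hsub := (Metric.ball_subset_ball hr).trans hball
        have h1 := (H ω).condRegret_stepSize_le hd hdT.le hc L β hρ hωstar.1 hsub
        calc _ ≤ ENNReal.ofReal _ := ENNReal.ofReal_le_ofReal h1
          _ ≤ _ := ENNReal.ofReal_add_le
          _ ≤ _ := by
            refine add_le_add le_rfl ?_
            rw [ENNReal.ofReal_natCast]
            exact le_iSup₂_of_le (f := fun ρ (_ : ρ ∈ {ρ | ρ ∈ Θ ∧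
              Metric.ball ρ ((T : ℝ) ^ (-β)) ⊆ Θ}) =>
                (Exp3Set.nonLipschitzCount L (fun t => l t ω) T ρ ((T : ℝ) ^ (-β)) : ℝ≥0∞))
              ρ ⟨hρ.1, hsub⟩ le_rfl
    _ ≤ ENNReal.ofReal (C₁ * Λ * S + L * P) + ENNReal.ofReal (|D| * Λ ^ q * P) := by
        -- Only the constant summand has to be measurable, so nothing is needed about the supremum
        -- as a function of the draw.
        rw [lintegral_add_left measurable_const, lintegral_const, measure_univ, mul_one]
        refine add_le_add le_rfl ((hdisp T hT _ le_rfl).trans (ENNReal.ofReal_le_ofReal ?_))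
        rw [hTε, mul_comm ((T : ℝ) ^ (-β))]
        gcongr
        exact le_abs_self D
    _ = ENNReal.ofReal (C₁ * Λ * S + L * P + |D| * Λ ^ q * P) :=
        (ENNReal.ofReal_add (by positivity) (by positivity)).symm
    _ ≤ _ := by
        refine ENNReal.ofReal_le_ofReal ?_
        have hΛ1 : Λ ≤ Λ ^ (q + 1) := le_self_pow₀ hΛ (Nat.succ_ne_zero q)
        have hΛq : Λ ^ q ≤ Λ ^ (q + 1) := pow_le_pow_right₀ hΛ (Nat.le_succ q)
        calc C₁ * Λ * S + L * P + |D| * Λ ^ q * P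
            ≤ C₁ * Λ ^ (q + 1) * (S + P) + L * Λ ^ (q + 1) * (S + P)
              + |D| * Λ ^ (q + 1) * (S + P) := by
              have h1 : (L : ℝ) ≤ L * Λ ^ (q + 1) := le_mul_of_one_le_right hL hΛq1
              gcongr
              · linarith
              · linarith
              · linarith
          _ ≤ _ := by
              have : 0 ≤ (1 + 1 / r₀) * Λ ^ (q + 1) * (S + P) := by positivity
              linarith
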